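/- Let $n,d,r$ be integers with $r<d$, and let $\phi:\mathbb R\to\mathbb R$ be continuous, not a polynomial (in particular nonlinear), and differentiable with $|\phi(t)|\le M$ and $|\phi'(t)|\le L$ for all $t\in\mathbb R$. Let $x_1,\dots,x_n\in\mathbb R^d$ (the rows of $X\in\mathbb R^{n\times d}$) satisfy $\|x_i\|_2=\sqrt d$ and lie in the $r$-dimensional column space of a matrix $U\in\mathbb R^{d\times r}$ with $U^\top U=I_r$. Assume that $\|x_i-x_j\|_2\ge\Delta$ for all $i\ne j$ and some $\Delta>0$. Let $y\in\mathbb R^n$. Consider the random feature model of width $p$, $f(x,\theta)=\varphi(x)^\top\theta$ with $\varphi(x)=\frac1{\sqrt p}\phi(Vx+b)$ ($\phi$ applied entrywise), where the entries of $V\in\mathbb R^{p\times d}$ are $\mathcal N(0,1/d)$, those of $b\in\mathbb R^p$ are $\mathcal N(0,1)$, and all of them are independent. Put $\Phi=[\varphi(x_1),\dots,\varphi(x_n)]^\top$ and, when $\Phi\Phi^\top$ is invertible, $\alpha=(\Phi\Phi^\top)^{-1}y$ and $\theta^*=\Phi^\top\alpha$ (the minimum-norm interpolator, reached by gradient descent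 from $\theta_0=0$). For $\hat X\in\mathbb R^{n\times d}$ with rows $\hat x_i$ and $\hat\alpha\in\mathbb R^n$ let $$\mathcal L_{\mathrm{recon}}(\hat X,\hat\alpha)=\Big\|\theta^*-\sum_{i=1}^n\hat\alpha_i\nabla_\theta f(\hat x_i,\theta^*)\Big\|_2^2 ,$$ and consider the reduced reconstruction problem $$\min_{\hat Z\in\mathbb R^{n\times r},\ \hat\alpha\in\mathbb R^n,\ \|\hat z_i\|_2=\sqrt d\ \forall i}\ \mathcal L_{\mathrm{recon}}(\hat ZU^\top,\hat\alpha).$$ Then there is a constant $C>0$, depending only on $\Delta$ and on the fixed $n,d,r,\phi$, such that the following holds for all $c>0$, $\delta>0$ and $p\in\mathbb N$. With probability at least $1-\delta$ over $(V,b)$: if $\Phi\Phi^\top$ is invertible and $|\alpha_i|\ge c$ for all $i$, then for every optimal solution $(\hat Z^*,\hat\alpha^*)$ of the reduced problem such that, with $S=\|\alpha\|_1+\|\hat\alpha^*\|_1$, $$\delta\le 16C(1+2r)LM\frac{S^2}{\sqrt r\,c^2}$$ and $$p\ge\frac{128\,C^2M^4(2r+1)S^4}{c^4}\left(\ln\Big(\frac{2+4r}{\delta}\Big)+\frac{2r}{2r+1}\ln\Big(\frac{24\,CLMS^2}{\sqrt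 r\,c^2}\Big)\right),$$ the rows $\hat x_1,\dots,\hat x_n$ of $\hat X^*=\hat Z^*U^\top$ recover the data: for every $j\in\{1,\dots,n\}$ there is an $i\in\{1,\dots,n\}$ with $\|x_j-\hat x_i\|_2<\Delta$. -/

import Mathlib

open MeasureTheory ProbabilityTheory
open scoped Matrix

namespace RFRecon

/-- The `i`-th row of a real matrix, as a vector with the Euclidean norm. -/
def row {m k : ℕ} (A : Matrix (Fin m) (Fin k) ℝ) (i : Fin m) : EuclideanSpace ℝ (Fin k) :=
  WithLp.toLp 2 (A i)

/-- The span of the columns of `U`, a subspace of Euclidean `d`-space. -/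
def colSpan {d r : ℕ} (U : Matrix (Fin d) (Fin r) ℝ) : Submodule ℝ (EuclideanSpace ℝ (Fin d)) :=
  Submodule.span ℝ (Set.range fun k : Fin r => row Uᵀ k)

/-- The columns of `U` are orthonormal, and the rows of `X` (the training samples) lie on the
sphere of radius `√d` intersected with the column span of `U`. -/
structure LowRankData {n d r : ℕ} (U : Matrix (Fin d) (Fin r) ℝ)
    (X : Matrix (Fin n) (Fin d) ℝ) : Prop where
  orthonormal : Uᵀ * U = 1
  on_sphere : ∀ i, ‖row X i‖ = √(d : ℝ)
  mem_colSpan : ∀ i, row X i ∈ colSpan U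

/-- The activation function is continuous, not a polynomial (in particular nonlinear), bounded by
`M`, and differentiable with derivative bounded by `L`. -/
structure IsActivation (φ : ℝ → ℝ) (M L : ℝ) : Prop where
  continuous : Continuous φ
  not_polynomial : ¬ ∃ q : Polynomial ℝ, ∀ t, φ t = q.eval t
  bounded : ∀ t, |φ t| ≤ M
  differentiable : Differentiable ℝ φ
  deriv_bounded : ∀ t, |deriv φ t| ≤ L

/-- The random feature vector `p^{-1/2} φ(V x + b)`, with `φ` applied entrywise. -/
noncomputable def features {p d : ℕ} (φ : ℝ → ℝ) (V : Matrix (Fin p) (Fin d) ℝ) (b : Fin p → ℝ)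
    (x : EuclideanSpace ℝ (Fin d)) : EuclideanSpace ℝ (Fin p) :=
  WithLp.toLp 2 fun k => 1 / √(p : ℝ) * φ ((V *ᵥ x.ofLp) k + b k)

/-- The random feature model `f(x, θ) = p^{-1/2} φ(V x + b)ᵀ θ`. -/
noncomputable def rfModel {p d : ℕ} (φ : ℝ → ℝ) (V : Matrix (Fin p) (Fin d) ℝ) (b : Fin p → ℝ)
    (x : EuclideanSpace ℝ (Fin d)) (θ : EuclideanSpace ℝ (Fin p)) : ℝ :=
  (features φ V b x).ofLp ⬝ᵥ θ.ofLp

/-- The law of the weights `(V, b)`: all entries are independent, those of `V` are `N(0, 1/d)` and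
those of `b` are `N(0, 1)`. -/
noncomputable def weightLaw (p d : ℕ) :
    Measure ((Fin p → Fin d → ℝ) × (Fin p → ℝ)) :=
  (Measure.pi fun _ : Fin p => Measure.pi fun _ : Fin d => gaussianReal 0 (1 / (d : NNReal))).prod
    (Measure.pi fun _ : Fin p => gaussianReal 0 1)

/-- The matrix `Φ` whose `i`-th row is the feature vector of the `i`-th training sample. -/
noncomputable def featureMatrix {n p d : ℕ} (φ : ℝ → ℝ) (V : Matrix (Fin p) (Fin d) ℝ)
    (b : Fin p → ℝ) (X : Matrix (Fin n) (Fin d) ℝ) : Matrix (Fin n) (Fin p) ℝ :=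
  Matrix.of fun i k => features φ V b (row X i) k

/-- The coefficients `α = (Φ Φᵀ)⁻¹ y`. -/
noncomputable def coeffs {n p : ℕ} (Φ : Matrix (Fin n) (Fin p) ℝ) (y : Fin n → ℝ) : Fin n → ℝ :=
  (Φ * Φᵀ)⁻¹ *ᵥ y

/-- The trained parameters `θ* = Φᵀ α = Φᵀ (Φ Φᵀ)⁻¹ y`. -/
noncomputable def thetaStar {n p : ℕ} (Φ : Matrix (Fin n) (Fin p) ℝ) (y : Fin n → ℝ) :
    EuclideanSpace ℝ (Fin p) :=
  WithLp.toLp 2 (Φᵀ *ᵥ coeffs Φ y)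

/-- The reconstruction loss `‖(θf - θ₀) - ∑ i, α̂ i ∇_θ f(x̂ i, θf)‖²` of a model `f` trained from
`θ₀` to `θf`. -/
noncomputable def reconLoss {n d m : ℕ}
    (f : EuclideanSpace ℝ (Fin d) → EuclideanSpace ℝ (Fin m) → ℝ)
    (θ₀ θf : EuclideanSpace ℝ (Fin m)) (Xhat : Matrix (Fin n) (Fin d) ℝ) (αhat : Fin n → ℝ) : ℝ :=
  ‖(θf - θ₀) - ∑ i, αhat i • gradient (f (row Xhat i)) θf‖ ^ 2

/-- `(Zhat, αhat)` is an optimal solution of the reduced reconstruction problem: minimize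
`reconLoss (Z Uᵀ) α` over all `Z` whose rows have norm `√d` and all `α`. -/
def IsOptimalReduced {n d r m : ℕ}
    (f : EuclideanSpace ℝ (Fin d) → EuclideanSpace ℝ (Fin m) → ℝ)
    (θ₀ θf : EuclideanSpace ℝ (Fin m)) (U : Matrix (Fin d) (Fin r) ℝ)
    (Zhat : Matrix (Fin n) (Fin r) ℝ) (αhat : Fin n → ℝ) : Prop :=
  (∀ i, ‖row Zhat i‖ = √(d : ℝ)) ∧
    ∀ (Z : Matrix (Fin n) (Fin r) ℝ) (α : Fin n → ℝ), (∀ i, ‖row Z i‖ = √(d : ℝ)) →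
      reconLoss f θ₀ θf (Zhat * Uᵀ) αhat ≤ reconLoss f θ₀ θf (Z * Uᵀ) α

/-- The norm `‖α‖₁`. -/
def l1 {n : ℕ} (α : Fin n → ℝ) : ℝ := ∑ i, |α i|

/-- The upper bound required of `δ` in dimension `r`, where `S` stands for `‖α‖₁ + ‖α̂‖₁`. -/
noncomputable def deltaBound (r : ℕ) (C L M c S : ℝ) : ℝ :=
  16 * C * (1 + 2 * r) * L * M * (S ^ 2 / (√(r : ℝ) * c ^ 2))

/-- The lower bound required of the width in dimension `r`, where `S` stands for
`‖α‖₁ + ‖α̂‖₁`. -/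
noncomputable def widthBound (r : ℕ) (C L M c S δ : ℝ) : ℝ :=
  128 * C ^ 2 * M ^ 4 * (2 * r + 1) * S ^ 4 / c ^ 4 *
    (Real.log ((2 + 4 * r) / δ) +
      2 * r / (2 * r + 1) * Real.log (24 * C * L * M * S ^ 2 / (√(r : ℝ) * c ^ 2)))

end RFRecon

/-!
The true data are feasible in the reduced problem and have loss zero, so every optimal solution has
loss zero: on each of the `p` neurons `w = (v, b)` the combination
`F w = ∑ i, α i φ(v · x i + b) - ∑ i, α̂ i φ(v · x̂ i + b)` vanishes
(`RFRecon.IsOptimalReduced.neuronSum_eq_zero`). If some `x j` were at distance at least `Δ` from all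
reconstructed points, it would be isolated among all points in this combination, with normalized
coefficient at least `c / S` in absolute value. Random neurons rule this out, as follows.

For points `x i` of norm `√d`, the shift of the weights by a multiple of `(-x i, d)` does not change
`v · x i + b`, and changes `v · x j + b` by a multiple of `‖x i - x j‖ ^ 2 / 2`. Taking differences
of `F` successively along such shifts, one for each `i ≠ j`, removes every term except that of
`x j`, and leaves the coefficient of `x j` times an iterated difference of `φ`
(`RFRecon.sum_powerset_neuronSum`). As `φ` is bounded and not constant, no iterated difference
with a suitable step vanishes identically (`RFRecon.exists_fwdDiff_iter_ne_zero`). Since separation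
bounds the shifts, and since on cubes the Gaussian law dominates a multiple of the translation
invariant Lebesgue measure, `|F|` exceeds a constant times its coefficient at `x j` with a
probability `q > 0` that depends neither on the coefficients nor on the points
(`RFRecon.exists_neuronLaw_detectSet_ge`). The event is a lower bound at single neurons, so
independence gives failure probability at most `(1 - q) ^ p` for one combination, and a union bound
over a finite net of coefficients and points treats all of them at once
(`RFRecon.exists_event_neuronSum_ne_zero`). This needs a width of order `(S / c) (log (1 / δ) + 1)`,
which the required width exceeds when `C` is large (`RFRecon.exists_forall_le_widthBound`).
-/

namespace RFRecon

/-! ### Iterated differences of combinations of neurons -/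

section

/-- A bounded function with vanishing second difference is affine, hence constant, along every
progression of step `s`. -/
lemma fwdDiff_eq_zero_of_fwdDiff_fwdDiff_eq_zero {g : ℝ → ℝ} {B s : ℝ} (hB : ∀ t, |g t| ≤ B)
    (h : ∀ t, fwdDiff s (fwdDiff s g) t = 0) (t : ℝ) : fwdDiff s g t = 0 := by
  have hper : ∀ m : ℕ, fwdDiff s g (t + m * s) = fwdDiff s g t := by
    intro m
    induction m with
    | zero => simp
    | succ m ih =>
      have := h (t + m * s)
      rw [fwdDiff, sub_eq_zero] at this
      rw [← ih, ← this]; congr 1; push_cast; ring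
  have hlin : ∀ m : ℕ, g (t + m * s) = g t + m * fwdDiff s g t := by
    intro m
    induction m with
    | zero => simp
    | succ m ih =>
      have := hper m
      have h2 : g (t + (m + 1 : ℕ) * s) = g (t + m * s + s) := by congr 1; push_cast; ring
      rw [fwdDiff] at this
      rw [h2]; push_cast; linarith
  by_contra hne
  obtain ⟨m, hm⟩ := exists_nat_gt (2 * B / |fwdDiff s g t|)
  rw [div_lt_iff₀ (abs_pos.mpr hne)] at hm
  have h1 : (m : ℝ) * |fwdDiff s g t| = |g (t + m * s) - g t| := by
    rw [hlin m, add_sub_cancel_left, abs_mul, Nat.abs_cast]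
  have h2 := abs_sub (g (t + m * s)) (g t)
  linarith [hB t, hB (t + m * s)]

/-- For bounded functions no higher difference operator kills more than the first one does. -/
lemma exists_fwdDiff_iter_ne_zero {g : ℝ → ℝ} {B s : ℝ} (hB : ∀ t, |g t| ≤ B)
    (h : ∃ t, fwdDiff s g t ≠ 0) (k : ℕ) : ∃ t, (fwdDiff s)^[k] g t ≠ 0 := by
  induction k generalizing g B with
  | zero =>
    by_contra! hc
    obtain ⟨t, ht⟩ := h
    exact ht (by simp only [Function.iterate_zero, id] at hc; simp [fwdDiff, hc])
  | succ k ih =>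
    refine ih (B := 2 * B) (fun t => ?_) ?_
    · have := abs_sub (g (t + s)) (g t)
      rw [fwdDiff]
      linarith [hB t, hB (t + s)]
    · by_contra! hc
      obtain ⟨t, ht⟩ := h
      exact ht (fwdDiff_eq_zero_of_fwdDiff_fwdDiff_eq_zero hB hc t)

section Alternating

variable {ι : Type*}

/-- An iterated difference, written as an alternating sum over sets of steps, vanishes as soon as
one of the steps is zero: `J` and `insert i J` cancel. -/
lemma sum_powerset_shift_eq_zero [DecidableEq ι] (g : ℝ → ℝ) (t : ℝ) {T : Finset ι}
    {e : ι → ℝ} {i : ι} (hi : i ∈ T) (he : e i = 0) :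
    ∑ J ∈ T.powerset, (-1 : ℝ) ^ J.card * g (t + ∑ l ∈ J, e l) = 0 := by
  rw [← Finset.insert_erase hi, Finset.sum_powerset_insert (Finset.notMem_erase i T),
    ← Finset.sum_add_distrib]
  refine Finset.sum_eq_zero fun J hJ => ?_
  have hiJ : i ∉ J := fun h => Finset.notMem_erase i T (Finset.mem_powerset.mp hJ h)
  rw [Finset.card_insert_of_notMem hiJ, Finset.sum_insert hiJ, he, pow_succ]
  simp

lemma sum_powerset_shift_eq_fwdDiff_iter (g : ℝ → ℝ) (t s : ℝ) {T : Finset ι} {e : ι → ℝ}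
    (he : ∀ i ∈ T, e i = s) :
    ∑ J ∈ T.powerset, (-1 : ℝ) ^ J.card * g (t + ∑ l ∈ J, e l)
      = (-1) ^ T.card * (fwdDiff s)^[T.card] g t := by
  have h1 : ∀ J ∈ T.powerset, (-1 : ℝ) ^ J.card * g (t + ∑ l ∈ J, e l)
      = (-1 : ℝ) ^ J.card * g (t + J.card • s) := by
    intro J hJ
    rw [Finset.sum_congr rfl fun l hl => he l (Finset.mem_powerset.mp hJ hl), Finset.sum_const]
  rw [Finset.sum_congr rfl h1,
    Finset.sum_powerset_apply_card (fun m => (-1 : ℝ) ^ m * g (t + m • s)),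
    fwdDiff_iter_eq_sum_shift, Finset.mul_sum]
  refine Finset.sum_congr rfl fun m hm => ?_
  have hm' : m ≤ T.card := Nat.lt_succ_iff.mp (Finset.mem_range.mp hm)
  have h2 : (-1 : ℝ) ^ T.card * (-1) ^ (T.card - m) = (-1) ^ m := by
    rw [← pow_add, show T.card + (T.card - m) = m + 2 * (T.card - m) by omega, pow_add, pow_mul]
    simp
  rw [nsmul_eq_mul, zsmul_eq_mul, ← h2]
  push_cast
  ring

end Alternating

/-- `∑ i, μ i φ(v · x i + b)` as a function of the weights `w = (v, b)` of one neuron: the value on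
that neuron of a linear combination of (unnormalized) random feature vectors. -/
def neuronSum {ι : Type*} [Fintype ι] {d : ℕ} (φ : ℝ → ℝ) (μ : ι → ℝ) (x : ι → Fin d → ℝ)
    (w : (Fin d → ℝ) × ℝ) : ℝ :=
  ∑ i, μ i * φ (w.1 ⬝ᵥ x i + w.2)

variable {ι : Type*} [Fintype ι] {d : ℕ}

/-- If the step `a i` moves the preactivation of the neuron `x j` by `s` and leaves that of `x i`
unchanged, then the iterated difference with steps `a i`, `i ≠ j`, annihilates every term of the
combination except the `j`-th. -/
lemma sum_powerset_neuronSum [DecidableEq ι] (φ : ℝ → ℝ) (μ : ι → ℝ) (x : ι → Fin d → ℝ)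
    (j : ι) (s : ℝ) (a : ι → (Fin d → ℝ) × ℝ)
    (hself : ∀ i, i ≠ j → (a i).1 ⬝ᵥ x i + (a i).2 = 0)
    (hj : ∀ i, i ≠ j → (a i).1 ⬝ᵥ x j + (a i).2 = s) (w : (Fin d → ℝ) × ℝ) :
    ∑ J ∈ (Finset.univ.erase j).powerset, (-1 : ℝ) ^ J.card * neuronSum φ μ x (w + ∑ i ∈ J, a i)
      = μ j * ((-1) ^ (Fintype.card ι - 1) *
          (fwdDiff s)^[Fintype.card ι - 1] φ (w.1 ⬝ᵥ x j + w.2)) := by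
  have hshift : ∀ (J : Finset ι) (l : ι), (w + ∑ i ∈ J, a i).1 ⬝ᵥ x l + (w + ∑ i ∈ J, a i).2
      = (w.1 ⬝ᵥ x l + w.2) + ∑ i ∈ J, ((a i).1 ⬝ᵥ x l + (a i).2) := by
    intro J l
    rw [Finset.sum_add_distrib, ← sum_dotProduct]
    simp only [Prod.fst_add, Prod.snd_add, Prod.fst_sum, Prod.snd_sum, add_dotProduct]
    ring
  have hcard : (Finset.univ.erase j).card = Fintype.card ι - 1 := by
    rw [Finset.card_erase_of_mem (Finset.mem_univ j), Finset.card_univ]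
  simp only [neuronSum, Finset.mul_sum, hshift]
  rw [Finset.sum_comm, Finset.sum_eq_single j]
  · rw [← hcard, ← sum_powerset_shift_eq_fwdDiff_iter φ _ s
      (e := fun i => (a i).1 ⬝ᵥ x j + (a i).2) (fun i hi => hj i (Finset.ne_of_mem_erase hi)),
      Finset.mul_sum]
    exact Finset.sum_congr rfl fun J _ => by ring
  · intro l _ hl
    have := sum_powerset_shift_eq_zero φ (w.1 ⬝ᵥ x l + w.2)
      (e := fun i => (a i).1 ⬝ᵥ x l + (a i).2) (i := l)
      (Finset.mem_erase.mpr ⟨hl, Finset.mem_univ l⟩) (hself l hl)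
    rw [← mul_zero (μ l), ← this, Finset.mul_sum]
    exact Finset.sum_congr rfl fun J _ => by ring
  · simp

/-- Pigeonhole form of `sum_powerset_neuronSum`: at one of the shifted weights the combination is
as large as the average of the iterated difference. -/
lemma exists_subset_le_abs_neuronSum [DecidableEq ι] (φ : ℝ → ℝ) (μ : ι → ℝ)
    (x : ι → Fin d → ℝ) (j : ι) (s : ℝ) (a : ι → (Fin d → ℝ) × ℝ)
    (hself : ∀ i, i ≠ j → (a i).1 ⬝ᵥ x i + (a i).2 = 0)
    (hj : ∀ i, i ≠ j → (a i).1 ⬝ᵥ x j + (a i).2 = s) (w : (Fin d → ℝ) × ℝ) :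
    ∃ J ∈ (Finset.univ.erase j).powerset,
      |μ j| * |(fwdDiff s)^[Fintype.card ι - 1] φ (w.1 ⬝ᵥ x j + w.2)| / 2 ^ (Fintype.card ι - 1)
        ≤ |neuronSum φ μ x (w + ∑ i ∈ J, a i)| := by
  by_contra! hc
  have h := Finset.sum_lt_sum_of_nonempty (Finset.powerset_nonempty _) hc
  rw [Finset.sum_const, Finset.card_powerset, Finset.card_erase_of_mem (Finset.mem_univ j),
    Finset.card_univ, nsmul_eq_mul, Nat.cast_pow, Nat.cast_ofNat,
    mul_div_cancel₀ _ (by positivity)] at h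
  have h2 := congrArg abs (sum_powerset_neuronSum φ μ x j s a hself hj w)
  rw [abs_mul, abs_mul, abs_pow, abs_neg, abs_one, one_pow, one_mul] at h2
  rw [← h2] at h
  refine absurd (Finset.abs_sum_le_sum_abs _ _) (not_le.mpr (lt_of_le_of_lt (le_of_eq ?_) h))
  exact Finset.sum_congr rfl fun J _ => by simp [abs_mul]

lemma continuous_neuronSum {φ : ℝ → ℝ} (hφ : Continuous φ) (μ : ι → ℝ) (x : ι → Fin d → ℝ) :
    Continuous (neuronSum φ μ x) := by
  unfold neuronSum dotProduct
  fun_prop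

end

/-! ### Anti-concentration at a single neuron -/

section

/-- The law of the weights `(v, b)` of a single neuron. -/
noncomputable def neuronLaw (d : ℕ) : Measure ((Fin d → ℝ) × ℝ) :=
  (Measure.pi fun _ : Fin d => gaussianReal 0 (1 / (d : NNReal))).prod (gaussianReal 0 1)

instance (d : ℕ) : IsProbabilityMeasure (neuronLaw d) := by
  unfold neuronLaw; infer_instance

/-- The cube of half-side `R` in the weight space of a single neuron. -/
def weightBox (d : ℕ) (R : ℝ) : Set ((Fin d → ℝ) × ℝ) :=
  (Set.univ.pi fun _ => Set.Icc (-R) R) ×ˢ Set.Icc (-R) R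

lemma mem_weightBox {d : ℕ} {R : ℝ} {w : (Fin d → ℝ) × ℝ} :
    w ∈ weightBox d R ↔ (∀ l, |w.1 l| ≤ R) ∧ |w.2| ≤ R := by
  simp only [weightBox, Set.mem_prod, Set.mem_univ_pi, Set.mem_Icc, abs_le]

lemma measurableSet_weightBox (d : ℕ) (R : ℝ) : MeasurableSet (weightBox d R) :=
  (MeasurableSet.univ_pi fun _ => measurableSet_Icc).prod measurableSet_Icc

/-- On a bounded interval the Gaussian density is at least its value at the endpoint. -/
lemma exists_smul_volume_restrict_le_gaussianReal {v : NNReal} (hv : v ≠ 0) (R : ℝ) :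
    ∃ c : ENNReal, c ≠ 0 ∧ c • volume.restrict (Set.Icc (-R) R) ≤ gaussianReal 0 v := by
  refine ⟨gaussianPDF 0 v R, (gaussianPDF_pos 0 hv R).ne', Measure.le_iff.mpr fun s hs => ?_⟩
  rw [Measure.smul_apply, Measure.restrict_apply hs, smul_eq_mul, gaussianReal_apply 0 hv]
  calc gaussianPDF 0 v R * volume (s ∩ Set.Icc (-R) R)
      = ∫⁻ _ in s ∩ Set.Icc (-R) R, gaussianPDF 0 v R := by rw [setLIntegral_const]
    _ ≤ ∫⁻ t in s ∩ Set.Icc (-R) R, gaussianPDF 0 v t := by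
        refine setLIntegral_mono' (hs.inter measurableSet_Icc) fun t ht => ?_
        have ht2 : t ^ 2 ≤ R ^ 2 := sq_le_sq' ht.2.1 ht.2.2
        rw [gaussianPDF, gaussianPDF]
        refine ENNReal.ofReal_le_ofReal ?_
        rw [gaussianPDFReal, gaussianPDFReal, sub_zero, sub_zero]
        gcongr
    _ ≤ ∫⁻ t in s, gaussianPDF 0 v t := lintegral_mono_set Set.inter_subset_left

/-- Domination of measures passes to finite powers. -/
lemma smul_pi_le_pi {ι : Type*} [Fintype ι] {α : Type*} [MeasurableSpace α] (ν ρ : Measure α)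
    [SigmaFinite ν] [SigmaFinite ρ] (c : ENNReal) (h : c • ν ≤ ρ) :
    c ^ Fintype.card ι • Measure.pi (fun _ : ι => ν) ≤ Measure.pi fun _ : ι => ρ := by
  -- The product measure is the largest outer measure with the prescribed bound on boxes.
  have hle : (c ^ Fintype.card ι • Measure.pi (fun _ : ι => ν)).toOuterMeasure
      ≤ OuterMeasure.pi fun _ : ι => ρ.toOuterMeasure := by
    refine OuterMeasure.le_pi.mpr fun s _ => ?_
    change (c ^ Fintype.card ι • Measure.pi (fun _ : ι => ν)) (Set.univ.pi s) ≤ _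
    rw [Measure.smul_apply, Measure.pi_pi, smul_eq_mul, ← Finset.card_univ, ← Finset.prod_const,
      ← Finset.prod_mul_distrib]
    exact Finset.prod_le_prod' fun i _ => by simpa using h (s i)
  refine Measure.le_iff.mpr fun s hs => ?_
  have heq : Measure.pi (fun _ : ι => ρ) s = OuterMeasure.pi (fun _ : ι => ρ.toOuterMeasure) s := by
    rw [Measure.pi_def, toMeasure_apply _ _ hs]
  rw [heq]
  exact hle s

lemma exists_mul_volume_le_neuronLaw {d : ℕ} (hd : d ≠ 0) (R : ℝ) :
    ∃ c : ENNReal, c ≠ 0 ∧ ∀ A : Set ((Fin d → ℝ) × ℝ), MeasurableSet A → A ⊆ weightBox d R →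
      c * volume A ≤ neuronLaw d A := by
  have hv : (1 / (d : NNReal)) ≠ 0 := by simpa using hd
  obtain ⟨c₁, h₁, hle₁⟩ := exists_smul_volume_restrict_le_gaussianReal hv R
  obtain ⟨c₂, h₂, hle₂⟩ := exists_smul_volume_restrict_le_gaussianReal one_ne_zero R
  refine ⟨c₁ ^ d * c₂, mul_ne_zero (pow_ne_zero _ h₁) h₂, fun A hA hAR => ?_⟩
  have h := smul_pi_le_pi (ι := Fin d) _ _ c₁ hle₁
  rw [Fintype.card_fin] at h
  have h' := Measure.prod_mono h hle₂ A
  rw [Measure.prod_smul_left, Measure.prod_smul_right, ← Measure.restrict_pi_pi,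
    Measure.prod_restrict, Measure.smul_apply, Measure.smul_apply,
    Measure.restrict_apply hA, smul_eq_mul, smul_eq_mul] at h'
  rw [show A ∩ (Set.univ.pi fun _ => Set.Icc (-R) R) ×ˢ Set.Icc (-R) R = A from
    Set.inter_eq_left.mpr hAR, ← mul_assoc] at h'
  exact h'

/-- The points `x i` have norm `√d`, and each of them other than `x j` is at distance at least `Δ`
from `x j`; on that sphere the latter is a bound on the inner product. -/
structure IsSeparatedFrom {ι : Type*} {d : ℕ} (Δ : ℝ) (x : ι → Fin d → ℝ) (j : ι) : Prop where
  dotProduct_self : ∀ i, x i ⬝ᵥ x i = d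
  dotProduct_le : ∀ i, i ≠ j → x i ⬝ᵥ x j ≤ d - Δ ^ 2 / 2

lemma abs_le_of_dotProduct_self {d : ℕ} {x : Fin d → ℝ} (h : x ⬝ᵥ x = d) (l : Fin d) :
    |x l| ≤ d := by
  have hd : (1 : ℝ) ≤ d := by exact_mod_cast l.pos
  have h1 : x l * x l ≤ d := by
    rw [← h]
    exact Finset.single_le_sum (f := fun l => x l * x l) (fun i _ => mul_self_nonneg _)
      (Finset.mem_univ l)
  refine abs_le_of_sq_le_sq ?_ (by positivity)
  nlinarith

lemma abs_dotProduct_le {d : ℕ} {v x : Fin d → ℝ} {A B : ℝ} (hv : ∀ l, |v l| ≤ A)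
    (hx : ∀ l, |x l| ≤ B) : |v ⬝ᵥ x| ≤ d * (A * B) := by
  refine (Finset.abs_sum_le_sum_abs _ _).trans ?_
  refine (Finset.sum_le_card_nsmul _ _ (A * B) fun l _ => ?_).trans_eq (by simp)
  rw [abs_mul]
  exact mul_le_mul (hv l) (hx l) (abs_nonneg _) ((abs_nonneg _).trans (hv l))

/-- With `u i = (x i, 1)`, the vector `(-x i, d)` is orthogonal to `u i`, and its inner product with
`u j` is `‖x i - x j‖ ^ 2 / 2`. Separation from `x j` therefore bounds the multiple that makes the
latter equal to `s`. -/
lemma exists_annihilating_shifts {ι : Type*} {d : ℕ} {Δ : ℝ} (hΔ : 0 < Δ) {x : ι → Fin d → ℝ} {j : ι}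
    (hx : IsSeparatedFrom Δ x j) (s : ℝ) :
    ∃ a : ι → (Fin d → ℝ) × ℝ, (∀ i, i ≠ j → (a i).1 ⬝ᵥ x i + (a i).2 = 0) ∧
      (∀ i, i ≠ j → (a i).1 ⬝ᵥ x j + (a i).2 = s) ∧
      ∀ i, a i ∈ weightBox d (|s| / (Δ ^ 2 / 2) * d) := by
  classical
  refine ⟨fun i => if i = j then 0 else
    (s / (d - x i ⬝ᵥ x j)) • (-x i, (d : ℝ)), fun i hi => ?_, fun i hi => ?_, fun i => ?_⟩
  · simp [hi, hx.dotProduct_self]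
  · have : (d : ℝ) - x i ⬝ᵥ x j ≠ 0 := by
      have := hx.dotProduct_le i hi
      have : 0 < Δ ^ 2 := by positivity
      intro h; linarith
    simp only [hi, if_false, Prod.smul_mk, smul_dotProduct, neg_dotProduct, smul_eq_mul]
    field_simp
    ring
  · rw [mem_weightBox]
    by_cases hi : i = j
    · simp only [hi, if_true, Prod.fst_zero, Prod.snd_zero, Pi.zero_apply, abs_zero]
      exact ⟨fun _ => by positivity, by positivity⟩
    · have hσ : |s / ((d : ℝ) - x i ⬝ᵥ x j)| ≤ |s| / (Δ ^ 2 / 2) := by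
        have h1 := hx.dotProduct_le i hi
        have h2 : 0 < Δ ^ 2 := by positivity
        rw [abs_div, abs_of_pos (a := (d : ℝ) - x i ⬝ᵥ x j) (by linarith)]
        gcongr
        linarith
      simp only [hi, if_false, Prod.smul_mk, Pi.smul_apply, Pi.neg_apply, smul_eq_mul, abs_mul,
        abs_neg, Nat.abs_cast]
      refine ⟨fun l => ?_, by gcongr⟩
      have := abs_le_of_dotProduct_self (hx.dotProduct_self i) l
      gcongr

variable {ι : Type*} [Fintype ι] {d : ℕ}

lemma sum_mem_weightBox (a : ι → (Fin d → ℝ) × ℝ) {A : ℝ} (ha : ∀ i, a i ∈ weightBox d A)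
    (J : Finset ι) : ∑ i ∈ J, a i ∈ weightBox d (Fintype.card ι * A) := by
  simp only [mem_weightBox] at ha ⊢
  have key : ∀ f : ι → ℝ, (∀ i, |f i| ≤ A) → |∑ i ∈ J, f i| ≤ Fintype.card ι * A := by
    intro f hf
    calc |∑ i ∈ J, f i| ≤ ∑ i ∈ J, |f i| := Finset.abs_sum_le_sum_abs _ _
      _ ≤ ∑ i, |f i| :=
        Finset.sum_le_sum_of_subset_of_nonneg (Finset.subset_univ _) fun i _ _ => abs_nonneg _
      _ ≤ Fintype.card ι * A := (Finset.sum_le_card_nsmul _ _ A fun i _ => hf i).trans_eq (by simp)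
  rw [Prod.fst_sum, Prod.snd_sum]
  refine ⟨fun l => ?_, key _ fun i => (ha i).2⟩
  rw [Finset.sum_apply]
  exact key _ fun i => (ha i).1 l

lemma add_mem_weightBox {w w' : (Fin d → ℝ) × ℝ} {A B : ℝ} (hw : w ∈ weightBox d A)
    (hw' : w' ∈ weightBox d B) : w + w' ∈ weightBox d (A + B) := by
  rw [mem_weightBox] at *
  exact ⟨fun l => (abs_add_le _ _).trans (add_le_add (hw.1 l) (hw'.1 l)),
    (abs_add_le _ _).trans (add_le_add hw.2 hw'.2)⟩

/-- The weights in the cube of half-side `R` at which a combination of neurons is at least `ε` in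
absolute value. -/
def detectSet (φ : ℝ → ℝ) (μ : ι → ℝ) (x : ι → Fin d → ℝ) (R ε : ℝ) : Set ((Fin d → ℝ) × ℝ) :=
  weightBox d R ∩ {w | ε ≤ |neuronSum φ μ x w|}

lemma measurableSet_detectSet {φ : ℝ → ℝ} (hφ : Continuous φ) (μ : ι → ℝ) (x : ι → Fin d → ℝ)
    (R ε : ℝ) : MeasurableSet (detectSet φ μ x R ε) :=
  (measurableSet_weightBox d R).inter
    (isClosed_le continuous_const (continuous_neuronSum hφ μ x).abs).measurableSet

/-- If `ψ` does not vanish at `t₀`, it is bounded below near `t₀`, and for `b` near `t₀` and `v`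
small the preactivation `v · x + b` stays near `t₀` for all `x` of norm `√d` at once. -/
lemma exists_box_le_abs {ψ : ℝ → ℝ} (hψ : Continuous ψ) {t₀ : ℝ} (ht₀ : ψ t₀ ≠ 0) (d : ℕ) :
    ∃ (ε R : ℝ) (Q : Set ((Fin d → ℝ) × ℝ)), 0 < ε ∧ volume Q ≠ 0 ∧ Q ⊆ weightBox d R ∧
      ∀ x : Fin d → ℝ, x ⬝ᵥ x = d → ∀ w ∈ Q, ε ≤ |ψ (w.1 ⬝ᵥ x + w.2)| := by
  have hpos : 0 < |ψ t₀| := abs_pos.mpr ht₀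
  obtain ⟨η, hη, hnear⟩ : ∃ η > 0, ∀ t, |t - t₀| < η → |ψ t₀| / 2 ≤ |ψ t| := by
    have h := (hψ.abs.tendsto t₀).eventually (lt_mem_nhds (half_lt_self hpos))
    obtain ⟨η, hη, h⟩ := Metric.eventually_nhds_iff.mp h
    exact ⟨η, hη, fun t ht => (h (by rwa [Real.dist_eq])).le⟩
  set ρ := η / (4 * ((d : ℝ) * d + 1)) with hρ
  have hρ0 : 0 < ρ := by positivity
  refine ⟨|ψ t₀| / 2, ρ + (|t₀| + η),
    (Set.univ.pi fun _ => Set.Icc (-ρ) ρ) ×ˢ Set.Icc (t₀ - η / 2) (t₀ + η / 2),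
    half_pos hpos, ?_, ?_, ?_⟩
  · rw [Measure.volume_eq_prod, Measure.prod_prod, volume_pi_pi]
    refine mul_ne_zero (Finset.prod_ne_zero_iff.mpr fun i _ => ?_) ?_ <;>
      rw [Real.volume_Icc] <;> simp <;> linarith
  · intro w hw
    have h1 : ∀ l, |w.1 l| ≤ ρ := fun l => abs_le.mpr (hw.1 l trivial)
    have h2 : |w.2 - t₀| ≤ η / 2 := abs_le.mpr ⟨by linarith [hw.2.1], by linarith [hw.2.2]⟩
    have h3 := abs_sub_abs_le_abs_sub w.2 t₀
    rw [mem_weightBox]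
    exact ⟨fun l => (h1 l).trans (by linarith [abs_nonneg t₀]), by linarith⟩
  · intro x hx w hw
    have h1 : ∀ l, |w.1 l| ≤ ρ := fun l => abs_le.mpr (hw.1 l trivial)
    have h2 : |w.2 - t₀| ≤ η / 2 := abs_le.mpr ⟨by linarith [hw.2.1], by linarith [hw.2.2]⟩
    have h3 := abs_dotProduct_le h1 (abs_le_of_dotProduct_self hx)
    have h4 : (d : ℝ) * (ρ * d) ≤ η / 4 := by
      rw [hρ, le_div_iff₀ (by norm_num)]
      have : (d : ℝ) * (η / (4 * (d * d + 1)) * d) * 4 = η * (d * d / (d * d + 1)) := by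
        field_simp
      rw [this]
      exact mul_le_of_le_one_right hη.le ((div_le_one (by positivity)).mpr (by linarith))
    refine hnear _ ?_
    have h5 := abs_add_le (w.1 ⬝ᵥ x) (w.2 - t₀)
    rw [add_sub_assoc]
    linarith

/-- Anti-concentration: a combination of neurons whose `j`-th point is isolated is at least of
order `|μ j|` with probability bounded below, uniformly in the coefficients and the points. A fixed
box of weights is covered by translates of the set in question, and Lebesgue measure, which the
Gaussian law dominates on a large cube, is translation invariant. -/
theorem exists_neuronLaw_detectSet_ge {φ : ℝ → ℝ} {M : ℝ} (hφ : Continuous φ)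
    (hM : ∀ t, |φ t| ≤ M) (hne : ∃ t s, φ t ≠ φ s) (hd : d ≠ 0) {Δ : ℝ} (hΔ : 0 < Δ) :
    ∃ κ R q : ℝ, 0 < κ ∧ 0 < R ∧ 0 < q ∧ ∀ (τ : ℝ) (μ : ι → ℝ) (x : ι → Fin d → ℝ) (j : ι),
      IsSeparatedFrom Δ x j → τ ≤ |μ j| →
        ENNReal.ofReal q ≤ neuronLaw d (detectSet φ μ x R (κ * τ)) := by
  classical
  obtain ⟨t₁, t₂, ht⟩ := hne
  set s := t₂ - t₁ with hs
  set k := Fintype.card ι - 1 with hk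
  obtain ⟨t₀, ht₀⟩ := exists_fwdDiff_iter_ne_zero (s := s) hM
    ⟨t₁, by rw [fwdDiff, hs, add_sub_cancel]; exact sub_ne_zero.mpr ht.symm⟩ k
  have hψ : Continuous ((fwdDiff s)^[k] φ) := by
    have : (fwdDiff s)^[k] φ = fun t =>
        ∑ m ∈ Finset.range (k + 1), ((-1 : ℤ) ^ (k - m) * k.choose m) • φ (t + m • s) :=
      funext fun t => fwdDiff_iter_eq_sum_shift s φ k t
    rw [this]
    fun_prop
  obtain ⟨ε, R₀, Q, hε, hQ, hQR, hQψ⟩ := exists_box_le_abs hψ ht₀ d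
  set A := |s| / (Δ ^ 2 / 2) * d with hA
  set R := max 1 (R₀ + Fintype.card ι * A) with hR
  obtain ⟨c, hc, hcle⟩ := exists_mul_volume_le_neuronLaw hd R
  -- The minimum with `1` only keeps the constant finite.
  have hq0 : min 1 (c * (volume Q / 2 ^ k)) ≠ 0 := by
    refine (lt_min one_pos (pos_iff_ne_zero.mpr (mul_ne_zero hc ?_))).ne'
    exact (ENNReal.div_pos hQ (by finiteness)).ne'
  have hq1 : min 1 (c * (volume Q / 2 ^ k)) ≠ ⊤ := ((min_le_left _ _).trans_lt (by simp)).ne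
  refine ⟨ε / 2 ^ k, R, (min 1 (c * (volume Q / 2 ^ k))).toReal, by positivity, by positivity,
    ENNReal.toReal_pos hq0 hq1, fun τ μ x j hx hτ => ?_⟩
  rw [ENNReal.ofReal_toReal hq1]
  refine (min_le_right _ _).trans (le_trans ?_
    (hcle _ (measurableSet_detectSet hφ _ _ _ _) Set.inter_subset_left))
  gcongr
  obtain ⟨a, ha₁, ha₂, ha₃⟩ := exists_annihilating_shifts hΔ hx s
  -- Each weight in `Q` is carried into the detecting set by one of the `2 ^ k` sums of shifts.
  have hcover : Q ⊆ ⋃ J ∈ (Finset.univ.erase j).powerset,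
      (fun w => w + ∑ i ∈ J, a i) ⁻¹' detectSet φ μ x R (ε / 2 ^ k * τ) := by
    intro w hw
    obtain ⟨J, hJ, hle⟩ := exists_subset_le_abs_neuronSum φ μ x j s a ha₁ ha₂ w
    refine Set.mem_biUnion hJ ⟨?_, le_trans ?_ hle⟩
    · have h := add_mem_weightBox (hQR hw) (sum_mem_weightBox a ha₃ J)
      rw [mem_weightBox] at h ⊢
      exact ⟨fun l => (h.1 l).trans (le_max_right _ _), h.2.trans (le_max_right _ _)⟩
    · rw [div_mul_eq_mul_div, mul_comm ε]
      have := hQψ (x j) (hx.dotProduct_self j) w hw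
      gcongr
  have hvol := (measure_mono hcover).trans (measure_biUnion_finset_le (μ := volume) _ _)
  have hinv : (volume : Measure ((Fin d → ℝ) × ℝ)).IsAddRightInvariant := by
    rw [Measure.volume_eq_prod]
    infer_instance
  rw [Finset.sum_congr rfl fun J _ => measure_preimage_add_right volume (∑ i ∈ J, a i) _] at hvol
  simp only [Finset.sum_const, Finset.card_powerset,
    Finset.card_erase_of_mem (Finset.mem_univ j), Finset.card_univ, nsmul_eq_mul, ← hk] at hvol
  refine ENNReal.div_le_of_le_mul ?_
  rw [mul_comm]
  exact_mod_cast hvol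

end

/-! ### All combinations at once -/

section

/-- A family of bounded parameters has a finite net inside the family, of size polynomial in the
inverse mesh: one member from each cell of the grid of mesh `η` that meets the family. -/
lemma exists_finset_net {P κ : Type*} [Fintype κ] (e : P → κ → ℝ) (S : Set P) {B η : ℝ}
    (hB : 0 ≤ B) (hη : 0 < η) (hS : ∀ θ ∈ S, ∀ i, |e θ i| ≤ B) :
    ∃ T : Finset P, (T : Set P) ⊆ S ∧ (T.card : ℝ) ≤ (2 * B / η + 3) ^ Fintype.card κ ∧
      ∀ θ ∈ S, ∃ θ' ∈ T, ∀ i, |e θ i - e θ' i| ≤ η := by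
  classical
  let g : P → κ → ℤ := fun θ i => ⌊e θ i / η⌋
  let G : Finset (κ → ℤ) := Fintype.piFinset fun _ => Finset.Icc ⌊-B / η⌋ ⌊B / η⌋
  have hg : Set.MapsTo g S G := by
    intro θ hθ
    rw [Finset.mem_coe, Fintype.mem_piFinset]
    intro i
    have := abs_le.mp (hS θ hθ i)
    exact Finset.mem_Icc.mpr ⟨Int.floor_mono (by gcongr; exact this.1),
      Int.floor_mono (by gcongr; exact this.2)⟩
  obtain ⟨T, hTS, hinj, himg⟩ := Set.SurjOn.exists_subset_injOn_image_eq (Set.surjOn_image g S)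
  have hfin : T.Finite := Set.Finite.of_finite_image
    (himg ▸ G.finite_toSet.subset hg.image_subset) hinj
  refine ⟨hfin.toFinset, by simpa using hTS, ?_, fun θ hθ => ?_⟩
  · have h1 : hfin.toFinset.card ≤ G.card :=
      Finset.card_le_card_of_injOn g (fun θ hθ => hg (hTS (by simpa using hθ)))
        (by simpa using hinj)
    have h2 : ((Finset.Icc ⌊-B / η⌋ ⌊B / η⌋).card : ℝ) ≤ 2 * B / η + 3 := by
      rw [Int.card_Icc]
      have h3 := Int.floor_le (B / η)
      have h4 := Int.sub_one_lt_floor (-B / η)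
      have h5 : 0 ≤ B / η := by positivity
      have h6 : ((⌊B / η⌋ + 1 - ⌊-B / η⌋).toNat : ℝ)
          = max ((⌊B / η⌋ : ℝ) + 1 - ⌊-B / η⌋) 0 := by
        exact_mod_cast congrArg (Int.cast : ℤ → ℝ) (Int.toNat_eq_max (⌊B / η⌋ + 1 - ⌊-B / η⌋))
      rw [h6, mul_div_assoc]
      rw [neg_div] at *
      exact max_le (by linarith) (by linarith)
    have h7 : G.card = (Finset.Icc ⌊-B / η⌋ ⌊B / η⌋).card ^ Fintype.card κ := by
      simp [G, Fintype.card_piFinset, Finset.card_univ]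
    calc (hfin.toFinset.card : ℝ) ≤ G.card := by exact_mod_cast h1
      _ = ((Finset.Icc ⌊-B / η⌋ ⌊B / η⌋).card : ℝ) ^ Fintype.card κ := by rw [h7]; push_cast; rfl
      _ ≤ _ := by gcongr
  · obtain ⟨θ', hθ', heq⟩ : g θ ∈ g '' T := himg ▸ Set.mem_image_of_mem g hθ
    refine ⟨θ', by simpa using hθ', fun i => ?_⟩
    have h := Int.abs_sub_lt_one_of_floor_eq_floor (congrFun heq i)
    rw [← sub_div, abs_div, abs_of_pos hη, div_lt_one hη] at h
    rw [abs_sub_comm]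
    exact h.le

/-- The neurons are independent and identically distributed. -/
lemma weightLaw_forall_mem (p d : ℕ) (A : Set ((Fin d → ℝ) × ℝ)) :
    weightLaw p d {ω | ∀ k, (ω.1 k, ω.2 k) ∈ A} = neuronLaw d A ^ p := by
  have h := (measurePreserving_arrowProdEquivProdArrow (Fin d → ℝ) ℝ (Fin p)
    (fun _ => Measure.pi fun _ : Fin d => gaussianReal 0 (1 / (d : NNReal)))
    (fun _ => gaussianReal 0 1)).measure_preimage_equiv {ω | ∀ k, (ω.1 k, ω.2 k) ∈ A}
  rw [weightLaw, ← h]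
  have hpre : MeasurableEquiv.arrowProdEquivProdArrow (Fin d → ℝ) ℝ (Fin p) ⁻¹'
      {ω | ∀ k, (ω.1 k, ω.2 k) ∈ A} = Set.univ.pi fun _ => A := by
    ext f
    simp [MeasurableEquiv.arrowProdEquivProdArrow, Equiv.arrowProdEquivProdArrow]
  rw [hpre, Measure.pi_pi]
  simp [neuronLaw]

lemma measurableSet_forall_mem (p d : ℕ) {A : Set ((Fin d → ℝ) × ℝ)} (hA : MeasurableSet A) :
    MeasurableSet {ω : (Fin p → Fin d → ℝ) × (Fin p → ℝ) | ∀ k, (ω.1 k, ω.2 k) ∈ A} := by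
  rw [Set.ofPred_forall]
  refine MeasurableSet.iInter fun k => ?_
  have hk : Measurable fun ω : (Fin p → Fin d → ℝ) × (Fin p → ℝ) => (ω.1 k, ω.2 k) := by fun_prop
  exact hk hA

instance (p d : ℕ) : IsProbabilityMeasure (weightLaw p d) := by
  unfold weightLaw; infer_instance

variable {ι : Type*} [Fintype ι] {d : ℕ}

lemma abs_neuronSum_sub_le {φ : ℝ → ℝ} {M L R η : ℝ} (hM : ∀ t, |φ t| ≤ M)
    (hL : ∀ a b, |φ a - φ b| ≤ L * |a - b|) (hL0 : 0 ≤ L) {μ μ' : ι → ℝ}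
    {x x' : ι → Fin d → ℝ} (hμ' : ∀ i, |μ' i| ≤ 1) (hμ : ∀ i, |μ i - μ' i| ≤ η)
    (hx : ∀ i l, |x i l - x' i l| ≤ η) {w : (Fin d → ℝ) × ℝ} (hw : w ∈ weightBox d R) :
    |neuronSum φ μ x w - neuronSum φ μ' x' w| ≤ Fintype.card ι * (M + L * (d * R)) * η := by
  rw [neuronSum, neuronSum, ← Finset.sum_sub_distrib]
  refine (Finset.abs_sum_le_sum_abs _ _).trans ((Finset.sum_le_card_nsmul _ _
    ((M + L * (d * R)) * η) fun i _ => ?_).trans_eq (by simp [mul_assoc]))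
  set t := w.1 ⬝ᵥ x i + w.2 with ht
  set t' := w.1 ⬝ᵥ x' i + w.2 with ht'
  have h1 : |t - t'| ≤ d * (R * η) := by
    rw [ht, ht', add_sub_add_right_eq_sub, ← dotProduct_sub]
    exact abs_dotProduct_le (mem_weightBox.mp hw).1 (hx i)
  have h2 : μ i * φ t - μ' i * φ t' = (μ i - μ' i) * φ t + μ' i * (φ t - φ t') := by ring
  have hη : 0 ≤ η := (abs_nonneg _).trans (hμ i)
  calc |μ i * φ t - μ' i * φ t'| ≤ |μ i - μ' i| * |φ t| + |μ' i| * |φ t - φ t'| := by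
        rw [h2, ← abs_mul, ← abs_mul]; exact abs_add_le _ _
    _ ≤ η * M + 1 * (L * (d * (R * η))) := by
        gcongr
        · exact hμ i
        · exact hM t
        · exact hμ' i
        · exact (hL t t').trans (by gcongr)
    _ = (M + L * (d * R)) * η := by ring

/-- With probability at least `1 - δ`, no combination of neurons with an isolated point of
coefficient at least `τ` vanishes on all `p` neurons. For one combination the failure probability
is at most `exp (-q p)`, and a net of `(G / τ) ^ D` combinations suffices. -/
theorem exists_event_neuronSum_ne_zero (ι : Type*) [Fintype ι] {d : ℕ} {φ : ℝ → ℝ} {M L : ℝ}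
    (hφ : Continuous φ) (hM : ∀ t, |φ t| ≤ M) (hL : ∀ a b, |φ a - φ b| ≤ L * |a - b|)
    (hne : ∃ t s, φ t ≠ φ s) (hd : d ≠ 0) {Δ : ℝ} (hΔ : 0 < Δ) :
    ∃ K : ℝ, 0 < K ∧ ∀ τ : ℝ, 0 < τ → τ ≤ 1 → ∀ δ : ℝ, 0 < δ → δ < 1 → ∀ p : ℕ,
      K / τ * (Real.log (1 / δ) + 1) ≤ p →
      ∃ E : Set ((Fin p → Fin d → ℝ) × (Fin p → ℝ)), MeasurableSet E ∧
        ENNReal.ofReal (1 - δ) ≤ weightLaw p d E ∧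
        ∀ ω ∈ E, ∀ (μ : ι → ℝ) (x : ι → Fin d → ℝ) (j : ι), (∀ i, |μ i| ≤ 1) → τ ≤ |μ j| →
          IsSeparatedFrom Δ x j → ∃ k, neuronSum φ μ x (ω.1 k, ω.2 k) ≠ 0 := by
  obtain ⟨κ, R, q, hκ, hR, hq, hdet⟩ := exists_neuronLaw_detectSet_ge (ι := ι) hφ hM hne hd hΔ
  have hM0 : 0 ≤ M := (abs_nonneg _).trans (hM 0)
  have hL0 : 0 ≤ L := by simpa using (abs_nonneg _).trans (hL 1 0)
  have hd1 : (1 : ℝ) ≤ d := by exact_mod_cast Nat.one_le_iff_ne_zero.mpr hd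
  -- `H` bounds the Lipschitz constant in the parameters, `D` is their number.
  set H := Fintype.card ι * (M + L * (d * R)) + 1 with hH
  have hH0 : 0 < H := by positivity
  set D := Fintype.card (ι ⊕ ι × Fin d) with hD
  set G := 4 * d * H / κ + 3 with hG
  have hG0 : 0 < G := by positivity
  refine ⟨(D * G + 1) / q, by positivity, fun τ hτ hτ1 δ hδ hδ1 p hp => ?_⟩
  set η := κ * τ / (2 * H) with hη
  have hη0 : 0 < η := by positivity
  let S : Set ((ι → ℝ) × (ι → Fin d → ℝ)) :=
    {θ | (∀ i, |θ.1 i| ≤ 1) ∧ ∃ j, τ ≤ |θ.1 j| ∧ IsSeparatedFrom Δ θ.2 j}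
  obtain ⟨T, hTS, hTcard, hT⟩ := exists_finset_net
    (fun θ : (ι → ℝ) × (ι → Fin d → ℝ) =>
      (Sum.elim θ.1 (fun il : ι × Fin d => θ.2 il.1 il.2) : ι ⊕ ι × Fin d → ℝ)) S
    (B := d) (η := η) (by positivity) hη0 (by
      rintro θ ⟨h1, j, -, hsep⟩ (i | ⟨i, l⟩)
      · exact (h1 i).trans hd1
      · exact abs_le_of_dotProduct_self (hsep.dotProduct_self i) l)
  let bad : (ι → ℝ) × (ι → Fin d → ℝ) → Set ((Fin p → Fin d → ℝ) × (Fin p → ℝ)) := fun θ =>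
    {ω | ∀ k, (ω.1 k, ω.2 k) ∈ (detectSet φ θ.1 θ.2 R (κ * τ))ᶜ}
  have hdm : ∀ θ : (ι → ℝ) × (ι → Fin d → ℝ),
      MeasurableSet (detectSet φ θ.1 θ.2 R (κ * τ))ᶜ :=
    fun θ => (measurableSet_detectSet hφ _ _ _ _).compl
  have hbadm : MeasurableSet (⋃ θ ∈ T, bad θ) :=
    Finset.measurableSet_biUnion _ fun θ _ => measurableSet_forall_mem p d (hdm θ)
  have hbad : ∀ θ ∈ T, weightLaw p d (bad θ) ≤ ENNReal.ofReal (Real.exp (-(q * p))) := by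
    intro θ hθ
    obtain ⟨-, j, hj, hsep⟩ := hTS hθ
    rw [weightLaw_forall_mem]
    have h1 : neuronLaw d (detectSet φ θ.1 θ.2 R (κ * τ))ᶜ ≤ ENNReal.ofReal (Real.exp (-q)) := by
      rw [prob_compl_eq_one_sub (measurableSet_detectSet hφ _ _ _ _)]
      refine (tsub_le_tsub_left (hdet τ θ.1 θ.2 j hsep hj) 1).trans ?_
      rw [← ENNReal.ofReal_one, ← ENNReal.ofReal_sub _ hq.le]
      exact ENNReal.ofReal_le_ofReal (by linarith [Real.add_one_le_exp (-q)])
    refine (pow_le_pow_left' h1 p).trans_eq ?_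
    rw [← ENNReal.ofReal_pow (Real.exp_pos _).le, ← Real.exp_nat_mul]
    congr 2; ring
  have hunion : weightLaw p d (⋃ θ ∈ T, bad θ) ≤ ENNReal.ofReal δ := by
    refine (measure_biUnion_finset_le _ _).trans ((Finset.sum_le_card_nsmul _ _ _ hbad).trans ?_)
    rw [nsmul_eq_mul, ← ENNReal.ofReal_natCast, ← ENNReal.ofReal_mul (by positivity)]
    refine ENNReal.ofReal_le_ofReal ?_
    have h1 : 2 * (d : ℝ) / η + 3 ≤ G / τ := by
      have h2 : 2 * (d : ℝ) / η = 4 * d * H / κ / τ := by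
        rw [hη]; field_simp; ring
      rw [h2, hG, add_div]
      gcongr
      exact le_div_self (by norm_num) hτ hτ1
    have h3 : (T.card : ℝ) ≤ Real.exp (D * (G / τ)) := by
      rw [Real.exp_nat_mul]
      refine hTcard.trans (pow_le_pow_left₀ (by positivity) (h1.trans ?_) _)
      linarith [Real.add_one_le_exp (G / τ)]
    have hlog : 0 ≤ Real.log (1 / δ) := Real.log_nonneg (by rw [le_div_iff₀ hδ]; linarith)
    have h4 : D * (G / τ) + Real.log (1 / δ) ≤ q * p := by
      have h5 : q * ((D * G + 1) / q / τ * (Real.log (1 / δ) + 1))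
          = (D * (G / τ) + 1 / τ) * (Real.log (1 / δ) + 1) := by field_simp
      have h6 : 1 ≤ 1 / τ := by rw [le_div_iff₀ hτ]; linarith
      have h7 := mul_le_mul_of_nonneg_left hp hq.le
      have h8 : 0 ≤ D * (G / τ) := by positivity
      rw [h5] at h7
      nlinarith [mul_nonneg h8 hlog, mul_nonneg (sub_nonneg.mpr h6) hlog]
    calc (T.card : ℝ) * Real.exp (-(q * p))
        ≤ Real.exp (D * (G / τ)) * Real.exp (-(q * p)) := by gcongr
      _ = Real.exp (D * (G / τ) - q * p) := by rw [← Real.exp_add]; ring_nf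
      _ ≤ Real.exp (Real.log δ) := by
          rw [one_div, Real.log_inv] at h4
          exact Real.exp_le_exp.mpr (by linarith)
      _ = δ := Real.exp_log hδ
  refine ⟨(⋃ θ ∈ T, bad θ)ᶜ, hbadm.compl, ?_, ?_⟩
  · rw [prob_compl_eq_one_sub hbadm, ENNReal.ofReal_sub _ hδ.le, ENNReal.ofReal_one]
    exact tsub_le_tsub_left hunion 1
  · intro ω hω μ x j hμ hj hsep
    obtain ⟨θ, hθT, hθ⟩ := hT (μ, x) ⟨hμ, j, hj, hsep⟩
    -- If `(μ, x)` vanished on every neuron, the nearby `θ` would go undetected by all of them.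
    by_contra! hzero
    refine hω (Set.mem_biUnion hθT fun k hk => ?_)
    have h1 := abs_neuronSum_sub_le hM hL hL0 (μ := μ) (x := x) (μ' := θ.1) (x' := θ.2)
      (hTS hθT).1 (fun i => hθ (Sum.inl i)) (fun i l => hθ (Sum.inr (i, l))) hk.1
    rw [hzero k, zero_sub, abs_neg] at h1
    have h2 : κ * τ ≤ |neuronSum φ θ.1 θ.2 (ω.1 k, ω.2 k)| := hk.2
    have h3 : H * η = κ * τ / 2 := by rw [hη]; field_simp
    have h4 : 0 < κ * τ := by positivity
    rw [hH] at h3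
    linarith

end

/-! ### Optimal solutions of the reduced problem -/

section

lemma norm_row_sq {m k : ℕ} (A : Matrix (Fin m) (Fin k) ℝ) (i : Fin m) :
    ‖row A i‖ ^ 2 = A i ⬝ᵥ A i := by
  rw [EuclideanSpace.real_norm_sq_eq]
  exact Finset.sum_congr rfl fun l _ => pow_two _

lemma norm_row_sub_row_sq {m m' k : ℕ} (A : Matrix (Fin m) (Fin k) ℝ)
    (B : Matrix (Fin m') (Fin k) ℝ) (i : Fin m) (j : Fin m') :
    ‖row A i - row B j‖ ^ 2 = A i ⬝ᵥ A i - 2 * (A i ⬝ᵥ B j) + B j ⬝ᵥ B j := by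
  rw [EuclideanSpace.real_norm_sq_eq]
  simp only [dotProduct, Finset.mul_sum, ← Finset.sum_sub_distrib, ← Finset.sum_add_distrib]
  exact Finset.sum_congr rfl fun l _ => by simp only [row, PiLp.sub_apply]; ring

lemma norm_row_eq_sqrt_iff {m k d : ℕ} (A : Matrix (Fin m) (Fin k) ℝ) (i : Fin m) :
    ‖row A i‖ = √(d : ℝ) ↔ A i ⬝ᵥ A i = d := by
  rw [← norm_row_sq, eq_comm, Real.sqrt_eq_iff_eq_sq (by positivity) (norm_nonneg _), eq_comm]

lemma mul_transpose_row_dotProduct {n d r : ℕ} {U : Matrix (Fin d) (Fin r) ℝ} (hU : Uᵀ * U = 1)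
    (Z : Matrix (Fin n) (Fin r) ℝ) (i : Fin n) :
    (Z * Uᵀ) i ⬝ᵥ (Z * Uᵀ) i = Z i ⬝ᵥ Z i := by
  have h : (Z * Uᵀ) * (Z * Uᵀ)ᵀ = Z * Zᵀ := by
    rw [Matrix.transpose_mul, Matrix.transpose_transpose, Matrix.mul_assoc,
      ← Matrix.mul_assoc Uᵀ, hU, Matrix.one_mul]
  exact congrFun (congrFun h i) i

/-- The data are a feasible point of the reduced problem: `Z = X U` reproduces `X`. -/
lemma LowRankData.mul_mul_transpose {n d r : ℕ} {U : Matrix (Fin d) (Fin r) ℝ}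
    {X : Matrix (Fin n) (Fin d) ℝ} (h : LowRankData U X) : X * U * Uᵀ = X := by
  have hc : ∀ i, ∃ c : Fin r → ℝ, ∑ k, c k • row Uᵀ k = row X i := fun i =>
    Submodule.mem_span_range_iff_exists_fun ℝ |>.mp (h.mem_colSpan i)
  choose c hc using hc
  have hX : X = Matrix.of c * Uᵀ := by
    ext i l
    have := congrArg (fun v : EuclideanSpace ℝ (Fin d) => v l) (hc i)
    simp only [row, WithLp.ofLp_sum, Finset.sum_apply, PiLp.smul_apply, smul_eq_mul] at this
    rw [← this, Matrix.mul_apply]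
    rfl
  rw [hX, Matrix.mul_assoc (Matrix.of c), h.orthonormal, Matrix.mul_one]

lemma gradient_rfModel {p d : ℕ} (φ : ℝ → ℝ) (V : Matrix (Fin p) (Fin d) ℝ) (b : Fin p → ℝ)
    (x : EuclideanSpace ℝ (Fin d)) (θ : EuclideanSpace ℝ (Fin p)) :
    gradient (rfModel φ V b x) θ = features φ V b x := by
  refine HasGradientAt.gradient (hasGradientAt_iff_hasFDerivAt.mpr ?_)
  have h : rfModel φ V b x = InnerProductSpace.toDual ℝ _ (features φ V b x) := by
    funext θ
    rw [InnerProductSpace.toDual_apply_apply, EuclideanSpace.inner_eq_star_dotProduct, rfModel,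
      dotProduct_comm]
    rfl
  rw [h]
  exact ContinuousLinearMap.hasFDerivAt _

lemma thetaStar_eq_sum {n p d : ℕ} (φ : ℝ → ℝ) (V : Matrix (Fin p) (Fin d) ℝ) (b : Fin p → ℝ)
    (X : Matrix (Fin n) (Fin d) ℝ) (y : Fin n → ℝ) :
    thetaStar (featureMatrix φ V b X) y
      = ∑ i, coeffs (featureMatrix φ V b X) y i • features φ V b (row X i) := by
  ext k
  simp [thetaStar, Matrix.mulVec, dotProduct, featureMatrix, mul_comm]

/-- The true data and coefficients are feasible with zero loss, so every optimal solution has zero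
loss. -/
lemma IsOptimalReduced.thetaStar_eq {n p d r : ℕ} {φ : ℝ → ℝ} {V : Matrix (Fin p) (Fin d) ℝ}
    {b : Fin p → ℝ} {U : Matrix (Fin d) (Fin r) ℝ} {X : Matrix (Fin n) (Fin d) ℝ} {y : Fin n → ℝ}
    (hX : LowRankData U X) {Zhat : Matrix (Fin n) (Fin r) ℝ} {αhat : Fin n → ℝ}
    (h : IsOptimalReduced (rfModel φ V b) 0 (thetaStar (featureMatrix φ V b X) y) U Zhat αhat) :
    thetaStar (featureMatrix φ V b X) y
      = ∑ i, αhat i • features φ V b (row (Zhat * Uᵀ) i) := by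
  have h0 := h.2 (X * U) (coeffs (featureMatrix φ V b X) y) fun i => by
    rw [norm_row_eq_sqrt_iff, ← mul_transpose_row_dotProduct hX.orthonormal, hX.mul_mul_transpose,
      ← norm_row_eq_sqrt_iff]
    exact hX.on_sphere i
  simp only [reconLoss, gradient_rfModel, sub_zero] at h0
  rw [hX.mul_mul_transpose, ← thetaStar_eq_sum, sub_self, norm_zero, zero_pow two_ne_zero] at h0
  have h1 := pow_eq_zero_iff two_ne_zero |>.mp (le_antisymm h0 (sq_nonneg _))
  exact sub_eq_zero.mp (norm_eq_zero.mp h1)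

end

/-! ### The width condition and the signed combination -/

lemma IsActivation.abs_sub_le {φ : ℝ → ℝ} {M L : ℝ} (h : IsActivation φ M L) (a b : ℝ) :
    |φ a - φ b| ≤ L * |a - b| := by
  have := convex_univ.norm_image_sub_le_of_norm_deriv_le (f := φ) (C := L) (x := b) (y := a)
    (fun t _ => h.differentiable t) (fun t _ => h.deriv_bounded t) trivial trivial
  simpa using this

lemma IsActivation.exists_ne {φ : ℝ → ℝ} {M L : ℝ} (h : IsActivation φ M L) :
    ∃ t s, φ t ≠ φ s := by
  by_contra! hc
  exact h.not_polynomial ⟨Polynomial.C (φ 0), fun t => by rw [Polynomial.eval_C, hc t 0]⟩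

/-- The required width dominates any fixed multiple of `(S / c) (log (1 / δ) + 1)` once `C` is
large. The bounds `M` and `L` are at least the fixed positive numbers `|φ t₀|` and `|φ' t₁|`, which
is why `C` need not depend on them. -/
lemma exists_forall_le_widthBound {φ : ℝ → ℝ} {M₁ L₁ : ℝ} (h₁ : IsActivation φ M₁ L₁) (r : ℕ)
    {K : ℝ} (hK : 0 < K) :
    ∃ C : ℝ, 0 < C ∧ ∀ M L : ℝ, IsActivation φ M L → r ≠ 0 → ∀ c S δ : ℝ, 0 < c → c ≤ S →
      0 < δ → δ < 1 →
        K * (S / c) * (Real.log (1 / δ) + 1) ≤ widthBound r C L M c S δ := by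
  obtain ⟨t, s, hts⟩ := h₁.exists_ne
  obtain ⟨t₀, ht₀⟩ : ∃ t₀, φ t₀ ≠ 0 := by
    by_contra! hc
    exact hts (by rw [hc, hc])
  obtain ⟨t₁, ht₁⟩ : ∃ t₁, deriv φ t₁ ≠ 0 := by
    by_contra! hc
    exact hts (is_const_of_deriv_eq_zero h₁.differentiable hc t s)
  set m := |φ t₀| with hm
  set l := |deriv φ t₁| with hl
  have hm0 : 0 < m := abs_pos.mpr ht₀
  have hl0 : 0 < l := abs_pos.mpr ht₁
  -- The second summand makes the second logarithm in `widthBound` nonnegative, the third one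
  -- absorbs `K`.
  set C := 1 + √(r : ℝ) / (24 * l * m) + K / m ^ 4 with hC
  have hC0 : 0 < C := by positivity
  refine ⟨C, hC0, fun M L hφ hr c S δ hc hS hδ hδ1 => ?_⟩
  have hmM : m ≤ M := hφ.bounded t₀
  have hlL : l ≤ L := hφ.deriv_bounded t₁
  have hr1 : (1 : ℝ) ≤ r := by exact_mod_cast Nat.one_le_iff_ne_zero.mpr hr
  have hM0 : 0 < M := hm0.trans_le hmM
  have hL0 : 0 < L := hl0.trans_le hlL
  set a := S / c with ha
  have ha1 : 1 ≤ a := (one_le_div hc).mpr hS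
  have hsqrt : 0 < √(r : ℝ) := Real.sqrt_pos.mpr (by linarith)
  have hC1 : 1 ≤ C := by
    have : 0 ≤ √(r : ℝ) / (24 * l * m) := by positivity
    have : 0 ≤ K / m ^ 4 := by positivity
    linarith
  have hCr : √(r : ℝ) ≤ 24 * C * l * m := by
    have h1 : √(r : ℝ) / (24 * l * m) ≤ C := by
      have : 0 ≤ K / m ^ 4 := by positivity
      linarith
    rw [div_le_iff₀ (by positivity)] at h1
    linarith
  have hCK : K ≤ C ^ 2 * M ^ 4 := by
    have h1 : K / m ^ 4 ≤ C := by
      have : 0 ≤ √(r : ℝ) / (24 * l * m) := by positivity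
      linarith
    rw [div_le_iff₀ (by positivity)] at h1
    calc K ≤ C * m ^ 4 := h1
      _ ≤ C ^ 2 * M ^ 4 := by
        gcongr
        nlinarith
  have hlog1 : Real.log (1 / δ) + 1 ≤ Real.log ((2 + 4 * r) / δ) := by
    have h1 : (1 : ℝ) ≤ Real.log (2 + 4 * r) := by
      rw [Real.le_log_iff_exp_le (by positivity)]
      linarith [Real.exp_one_lt_d9]
    rw [one_div, Real.log_inv, Real.log_div (by positivity) hδ.ne']
    linarith
  have hlog2 : 0 ≤ Real.log (24 * C * L * M * S ^ 2 / (√(r : ℝ) * c ^ 2)) := by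
    refine Real.log_nonneg ?_
    rw [one_le_div (by positivity)]
    have : 24 * C * l * m ≤ 24 * C * L * M := by gcongr
    have h2 : √(r : ℝ) ≤ 24 * C * L * M := hCr.trans this
    gcongr
  have hlog3 : 0 ≤ Real.log (1 / δ) := Real.log_nonneg ((one_le_div hδ).mpr hδ1.le)
  have hpre : K * a ≤ 128 * C ^ 2 * M ^ 4 * (2 * r + 1) * S ^ 4 / c ^ 4 := by
    have h1 : 128 * C ^ 2 * M ^ 4 * (2 * r + 1) * S ^ 4 / c ^ 4
        = (C ^ 2 * M ^ 4) * a ^ 4 * (128 * (2 * r + 1)) := by rw [ha]; field_simp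
    have h2 : a ≤ a ^ 4 := le_self_pow₀ ha1 (by norm_num)
    rw [h1]
    calc K * a ≤ (C ^ 2 * M ^ 4) * a ^ 4 := by gcongr
      _ ≤ (C ^ 2 * M ^ 4) * a ^ 4 * (128 * (2 * r + 1)) :=
        le_mul_of_one_le_right (by positivity) (by linarith)
  rw [widthBound]
  exact mul_le_mul hpre (hlog1.trans (le_add_of_nonneg_right (by positivity))) (by linarith)
    (by positivity)

lemma abs_le_l1 {n : ℕ} (α : Fin n → ℝ) (i : Fin n) : |α i| ≤ l1 α :=
  Finset.single_le_sum (f := fun i => |α i|) (fun _ _ => abs_nonneg _) (Finset.mem_univ i)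

lemma l1_nonneg {n : ℕ} (α : Fin n → ℝ) : 0 ≤ l1 α :=
  Finset.sum_nonneg fun _ _ => abs_nonneg _

/-- At an optimal solution the signed combination of true and reconstructed points vanishes on
every neuron. -/
lemma IsOptimalReduced.neuronSum_eq_zero {n p d r : ℕ} {φ : ℝ → ℝ} {V : Fin p → Fin d → ℝ}
    {b : Fin p → ℝ} {U : Matrix (Fin d) (Fin r) ℝ} {X : Matrix (Fin n) (Fin d) ℝ} {y : Fin n → ℝ}
    (hX : LowRankData U X) {Zhat : Matrix (Fin n) (Fin r) ℝ} {αhat : Fin n → ℝ}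
    (h : IsOptimalReduced (rfModel φ (Matrix.of V) b) 0
      (thetaStar (featureMatrix φ (Matrix.of V) b X) y) U Zhat αhat) (S : ℝ) (k : Fin p) :
    neuronSum φ (Sum.elim (fun i => coeffs (featureMatrix φ (Matrix.of V) b X) y i / S)
      fun i => -αhat i / S) (Sum.elim (fun i => X i) (fun i => (Zhat * Uᵀ) i)) (V k, b k) = 0 := by
  have h1 := congrArg (fun v : EuclideanSpace ℝ (Fin p) => v k)
    ((thetaStar_eq_sum φ (Matrix.of V) b X y).symm.trans (h.thetaStar_eq hX))
  simp only [WithLp.ofLp_sum, Finset.sum_apply, PiLp.smul_apply, smul_eq_mul, features] at h1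
  have hp : 1 / √(p : ℝ) ≠ 0 := by
    have : (0 : ℝ) < p := by exact_mod_cast k.pos
    positivity
  have h2 : ∀ (β : Fin n → ℝ) (Y : Matrix (Fin n) (Fin d) ℝ),
      ∑ i, β i * (1 / √(p : ℝ) * φ ((Matrix.of V *ᵥ (row Y i).ofLp) k + b k))
        = 1 / √(p : ℝ) * ∑ i, β i * φ (V k ⬝ᵥ Y i + b k) := by
    intro β Y
    rw [Finset.mul_sum]
    exact Finset.sum_congr rfl fun i _ => by
      rw [mul_left_comm]; rfl
  rw [h2, h2] at h1
  have h3 := mul_left_cancel₀ hp h1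
  rw [neuronSum, Fintype.sum_sum_type]
  change ∑ i, coeffs (featureMatrix φ (Matrix.of V) b X) y i / S * φ (V k ⬝ᵥ X i + b k)
    + ∑ i, -αhat i / S * φ (V k ⬝ᵥ (Zhat * Uᵀ) i + b k) = 0
  simp only [div_mul_eq_mul_div, neg_mul, ← Finset.sum_div, Finset.sum_neg_distrib]
  rw [h3]
  ring

lemma isSeparatedFrom_sumElim {n d r : ℕ} {Δ : ℝ} (hΔ : 0 < Δ) {U : Matrix (Fin d) (Fin r) ℝ}
    {X : Matrix (Fin n) (Fin d) ℝ} (hX : LowRankData U X)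
    (hsep : ∀ i j, i ≠ j → Δ ≤ ‖row X i - row X j‖) {Zhat : Matrix (Fin n) (Fin r) ℝ}
    (hZ : ∀ i, ‖row Zhat i‖ = √(d : ℝ)) (j : Fin n)
    (hfar : ∀ i, Δ ≤ ‖row X j - row (Zhat * Uᵀ) i‖) :
    IsSeparatedFrom Δ (Sum.elim (fun i => X i) (fun i => (Zhat * Uᵀ) i) : Fin n ⊕ Fin n → Fin d → ℝ) (Sum.inl j) := by
  have hX' : ∀ i, X i ⬝ᵥ X i = d := fun i => (norm_row_eq_sqrt_iff X i).mp (hX.on_sphere i)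
  have hZ' : ∀ i, (Zhat * Uᵀ) i ⬝ᵥ (Zhat * Uᵀ) i = d := fun i => by
    rw [mul_transpose_row_dotProduct hX.orthonormal]
    exact (norm_row_eq_sqrt_iff Zhat i).mp (hZ i)
  refine ⟨Sum.rec hX' hZ', ?_⟩
  rintro (i | i) hi
  · have h := pow_le_pow_left₀ hΔ.le (hsep i j fun h => hi (congrArg _ h)) 2
    rw [norm_row_sub_row_sq, hX', hX'] at h
    change X i ⬝ᵥ X j ≤ d - Δ ^ 2 / 2
    linarith
  · have h := pow_le_pow_left₀ hΔ.le (hfar i) 2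
    rw [norm_row_sub_row_sq, hX', hZ', dotProduct_comm] at h
    change (Zhat * Uᵀ) i ⬝ᵥ X j ≤ d - Δ ^ 2 / 2
    linarith

end RFRecon

theorem corollary1 (n d r : ℕ) (hrd : r < d) (φ : ℝ → ℝ) (Δ : ℝ) (hΔ : 0 < Δ) :
    ∃ C : ℝ, 0 < C ∧
      ∀ (M L : ℝ), RFRecon.IsActivation φ M L →
      ∀ (U : Matrix (Fin d) (Fin r) ℝ) (X : Matrix (Fin n) (Fin d) ℝ) (y : Fin n → ℝ),
        RFRecon.LowRankData U X →
        (∀ i j, i ≠ j → Δ ≤ ‖RFRecon.row X i - RFRecon.row X j‖) →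
      ∀ (c : ℝ), 0 < c → ∀ (δ : ℝ), 0 < δ → ∀ (p : ℕ),
        ∃ E : Set ((Fin p → Fin d → ℝ) × (Fin p → ℝ)), MeasurableSet E ∧
          ENNReal.ofReal (1 - δ) ≤ RFRecon.weightLaw p d E ∧
          ∀ V b, (V, b) ∈ E →
            let Φ := RFRecon.featureMatrix φ (Matrix.of V) b X
            let α := RFRecon.coeffs Φ y
            IsUnit (Φ * Φᵀ) → (∀ i, c ≤ |α i|) →
            ∀ (Zhat : Matrix (Fin n) (Fin r) ℝ) (αhat : Fin n → ℝ),
              RFRecon.IsOptimalReduced (RFRecon.rfModel φ (Matrix.of V) b) 0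
                (RFRecon.thetaStar Φ y) U Zhat αhat →
              δ ≤ RFRecon.deltaBound r C L M c (RFRecon.l1 α + RFRecon.l1 αhat) →
              RFRecon.widthBound r C L M c (RFRecon.l1 α + RFRecon.l1 αhat) δ ≤ (p : ℝ) →
              ∀ j, ∃ i, ‖RFRecon.row X j - RFRecon.row (Zhat * Uᵀ) i‖ < Δ := by
  by_cases hact : ∃ M₁ L₁, RFRecon.IsActivation φ M₁ L₁
  swap
  · exact ⟨1, one_pos, fun M L h => absurd ⟨M, L, h⟩ hact⟩
  obtain ⟨M₁, L₁, h₁⟩ := hact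
  obtain ⟨K, hK, hevent⟩ := RFRecon.exists_event_neuronSum_ne_zero (Fin n ⊕ Fin n)
    h₁.continuous h₁.bounded h₁.abs_sub_le h₁.exists_ne (Nat.ne_zero_of_lt hrd) hΔ
  obtain ⟨C, hC, hwidth⟩ := RFRecon.exists_forall_le_widthBound h₁ r hK
  refine ⟨C, hC, fun M L hφ U X y hX hsep c hc δ hδ p => ?_⟩
  -- For `1 ≤ δ` the probability requirement is empty.
  rcases le_or_gt 1 δ with hδ1 | hδ1
  · exact ⟨∅, MeasurableSet.empty, by simp [hδ1], by simp⟩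
  have hlog : 0 < Real.log (1 / δ) + 1 := by
    have := Real.log_nonneg ((one_le_div hδ).mpr hδ1.le)
    linarith
  -- The event must not depend on `S`, so it is taken for the largest ratio `S / c` that the
  -- width allows.
  set a := p / (K * (Real.log (1 / δ) + 1)) with ha
  have hratio : ∀ (α αhat : Fin n → ℝ), (∀ i, c ≤ |α i|) → Fin n →
      δ ≤ RFRecon.deltaBound r C L M c (RFRecon.l1 α + RFRecon.l1 αhat) →
      RFRecon.widthBound r C L M c (RFRecon.l1 α + RFRecon.l1 αhat) δ ≤ (p : ℝ) →
      c ≤ RFRecon.l1 α + RFRecon.l1 αhat ∧ (RFRecon.l1 α + RFRecon.l1 αhat) / c ≤ a := by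
    intro α αhat hα j hδS hpS
    -- In dimension `r = 0` the bound on `δ` is a division by zero and fails.
    have hr : r ≠ 0 := by
      rintro rfl
      simp [RFRecon.deltaBound] at hδS
      linarith
    have hcS : c ≤ RFRecon.l1 α + RFRecon.l1 αhat := by
      linarith [hα j, RFRecon.abs_le_l1 α j, RFRecon.l1_nonneg αhat]
    refine ⟨hcS, ?_⟩
    rw [ha, le_div_iff₀ (by positivity)]
    linarith [hwidth M L hφ hr c _ δ hc hcS hδ hδ1]
  rcases lt_or_ge a 1 with ha1 | ha1
  · refine ⟨Set.univ, MeasurableSet.univ, by simp [hδ.le], ?_⟩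
    intro V b _ Φ α _ hα Zhat αhat _ hδS hpS j
    obtain ⟨hcS, hSa⟩ := hratio α αhat hα j hδS hpS
    exact absurd (((one_le_div hc).mpr hcS).trans hSa) (not_le.mpr ha1)
  have ha0 : 0 < a := one_pos.trans_le ha1
  obtain ⟨E, hE, hprob, hgood⟩ := hevent a⁻¹ (by positivity) (inv_le_one_of_one_le₀ ha1) δ hδ hδ1 p
    (le_of_eq (by rw [div_inv_eq_mul, ha]; field_simp))
  refine ⟨E, hE, hprob, ?_⟩
  intro V b hVb Φ α _ hα Zhat αhat hopt hδS hpS j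
  by_contra! hfar
  obtain ⟨hcS, hSa⟩ := hratio α αhat hα j hδS hpS
  set S := RFRecon.l1 α + RFRecon.l1 αhat with hS
  have hS0 : 0 < S := hc.trans_le hcS
  have hle : ∀ i, |Sum.elim (fun i => α i / S) (fun i => -αhat i / S) i| ≤ 1 := by
    rintro (i | i)
    · rw [Sum.elim_inl, abs_div, abs_of_pos hS0, div_le_one hS0]
      linarith [RFRecon.abs_le_l1 α i, RFRecon.l1_nonneg αhat]
    · rw [Sum.elim_inr, abs_div, abs_of_pos hS0, div_le_one hS0, abs_neg]
      linarith [RFRecon.abs_le_l1 αhat i, RFRecon.l1_nonneg α]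
  have hge : a⁻¹ ≤ |α j / S| := by
    rw [abs_div, abs_of_pos hS0]
    calc a⁻¹ ≤ (S / c)⁻¹ := inv_anti₀ (by positivity) hSa
      _ = c / S := inv_div S c
      _ ≤ |α j| / S := by gcongr; exact hα j
  obtain ⟨k, hk⟩ := hgood (V, b) hVb _ _ (Sum.inl j) hle hge
    (RFRecon.isSeparatedFrom_sumElim hΔ hX hsep hopt.1 j hfar)
  exact hk (hopt.neuronSum_eq_zero hX S k)
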